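/- Let $n\ge 1$ and let $v_1,\dots,v_n\in\mathbb{R}^n$ be linearly independent unit vectors. Let $C=\{\sum_{i=1}^n t_iv_i : t_1,\dots,t_n\ge 0\}$ be the cone they generate, let $V\in\mathbb{R}^{n\times n}$ be the matrix with columns $v_1,\dots,v_n$, and let the associated matrix $M_n(C)\in\mathbb{R}^{n\times n}$ have diagonal entries $1$ and $(i,j)$ entry $-|v_i\cdot v_j|$ for $i\ne j$. Let $$\tilde\Omega_n(C)=\frac{\mathrm{vol}_{n-1}(C\cap S_{n-1})}{\mathrm{vol}_{n-1}(S_{n-1})}$$ be the normalized solid angle measure of $C$, where $S_{n-1}$ is the unit sphere of $\mathbb{R}^n$ centered at the origin. Suppose that $V^TV$ is tridiagonal, i.e. $v_i\cdot v_j=0$ whenever $|i-j|>1$, and put $\beta_i=v_i\cdot v_{i+1}$ for $1\le i\le n-1$. Then $M_n(C)$ and $V^TV$ have the same eigenvalues; indeed they have the same characteristic polynomial, so the eigenvalues agree with multiplicities. Moreover, $M_n(C)$ is positive definite, and the series in $n-1$ variables $$T_\beta=\frac{|\det V|}{(4\pi)^{n/2}}\sum_{b\in\mathbb{N}^{n-1}}\left[\frac{(-2)^{b_1+\cdots+b_{n-1}}}{\prod_{i=1}^{n-1}b_i!}\prod_{i=1}^{n}\Gamma\!\left(\frac{1+b_{i-1}+b_i}{2}\right)\right]\prod_{i=1}^{n-1}\beta_i^{b_i},$$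 where $\mathbb{N}=\{0,1,2,\dots\}$ and $b_0=b_n=0$, converges absolutely, and its sum is $\tilde\Omega_n(C)$. -/

import Mathlib

open MeasureTheory

noncomputable section

namespace SolidAngle

/-- The normalized solid angle measure of a subset `C` of `ℝⁿ`: the surface measure of the part of
the unit sphere lying in `C`, divided by the surface measure of the whole unit sphere.
Here `volume.toSphere` is the usual surface measure on the unit sphere. -/
def solidAngle {n : ℕ} (C : Set (EuclideanSpace ℝ (Fin n))) : ℝ :=
  (volume : Measure (EuclideanSpace ℝ (Fin n))).toSphere.real
      {x : Metric.sphere (0 : EuclideanSpace ℝ (Fin n)) 1 | (x : EuclideanSpace ℝ (Fin n)) ∈ C} /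
    (volume : Measure (EuclideanSpace ℝ (Fin n))).toSphere.real Set.univ

/-- The cone generated by `v 0, …, v (n - 1)`: all combinations with nonnegative coefficients. -/
def cone {n : ℕ} (v : Fin n → EuclideanSpace ℝ (Fin n)) :
    PointedCone ℝ (EuclideanSpace ℝ (Fin n)) :=
  PointedCone.hull ℝ (Set.range v)

/-- The matrix `V` whose `i`-th column is the vector `v i`. -/
def generatorMatrix {n : ℕ} (v : Fin n → EuclideanSpace ℝ (Fin n)) :
    Matrix (Fin n) (Fin n) ℝ :=
  Matrix.of fun r i => v i r

/-- The associated matrix: `1` on the diagonal, and `-|v i · v j|` off the diagonal. -/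
def associatedMatrix {n : ℕ} (v : Fin n → EuclideanSpace ℝ (Fin n)) :
    Matrix (Fin n) (Fin n) ℝ :=
  Matrix.of fun i j => if i = j then 1 else -|inner ℝ (v i) (v j)|

/-- A square matrix is tridiagonal if the entries with `|i - j| > 1` vanish. -/
def IsTridiagonal {n : ℕ} (A : Matrix (Fin n) (Fin n) ℝ) : Prop :=
  ∀ i j : Fin n, (i : ℕ) + 1 < j ∨ (j : ℕ) + 1 < i → A i j = 0

/-- The inner products of consecutive generators. -/
def beta {m : ℕ} (v : Fin (m + 1) → EuclideanSpace ℝ (Fin (m + 1))) (i : Fin m) : ℝ :=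
  inner ℝ (v i.castSucc) (v i.succ)

/-- The coefficient `A_b` of the series in `m = n - 1` variables, `n = m + 1`:
`(-2)^(b₁ + ⋯ + bₘ) / (b₁! ⋯ bₘ!) * ∏_{i = 1}^{m + 1} Γ ((1 + b_{i-1} + b_i) / 2)`,
with the convention `b₀ = b_{m+1} = 0`, so that the first and the last Gamma factors are
`Γ ((1 + b₁) / 2)` and `Γ ((1 + bₘ) / 2)`. -/
def seriesCoeff {m : ℕ} (b : Fin m → ℕ) : ℝ :=
  (-2 : ℝ) ^ (∑ i, b i) / (∏ i, ((b i).factorial : ℝ)) *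
    ∏ i : Fin (m + 1),
      Real.Gamma
        ((1 + ((Fin.cons 0 b : Fin (m + 1) → ℕ) i : ℝ) +
          ((Fin.snoc b 0 : Fin (m + 1) → ℕ) i : ℝ)) / 2)

/-- The term of multi-index `b` of the series `T_β`, including the prefactor
`|det V| / (4π)^(n/2)`, where `n = m + 1`. -/
def seriesTerm {m : ℕ} (v : Fin (m + 1) → EuclideanSpace ℝ (Fin (m + 1))) (b : Fin m → ℕ) : ℝ :=
  |(generatorMatrix v).det| / (4 * Real.pi) ^ (((m + 1 : ℕ) : ℝ) / 2) *
    (seriesCoeff b * ∏ i, beta v i ^ b i)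

end SolidAngle

end

/-! ### Algebra of tridiagonal Gram matrices. -/

namespace SolidAngle

/-! In polar coordinates the integral of `exp (-‖x‖²)` over a cone is `π^(n/2)` times its solid
angle. Substituting `x = V t` gives `|det V|` times the integral over the orthant of `exp (-‖V
t‖²)`, and tridiagonality makes the exponent `-∑ tᵢ² - 2 ∑ βᵢ tᵢ tᵢ₊₁`. Expanding the cross terms in
powers of `β` and integrating termwise produces the Gamma factors (`setIntegral_expansionTerm`).

The interchange is dominated convergence: on the orthant the absolute values of the terms are the
terms for `-|β|`, and these sum to `exp (-tᵀ M t)` with `M` the associated matrix. As the indices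
form a path, signs `d` can be chosen with `M = D VᵀV D`, where `D = diagonal d` and `D² = 1`
(`exists_associatedMatrix_eq`). So `M` is similar to `VᵀV`, is positive definite, and `tᵀ M t = ‖V D
t‖²` makes the bound integrable. -/

open Finset in
theorem hasSum_prod_pow_div_factorial {m : ℕ} (x : Fin m → ℝ) :
    HasSum (fun b : Fin m → ℕ => ∏ i, (x i ^ b i / ((b i).factorial : ℝ)))
      (Real.exp (∑ i, x i)) := by
  induction m with
  | zero => simp [hasSum_unique]
  | succ m ih =>
    have h0 (y : ℝ) : HasSum (fun k : ℕ => y ^ k / (k.factorial : ℝ)) (Real.exp y) := by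
      rw [Real.exp_eq_exp_ℝ]
      exact NormedSpace.expSeries_div_hasSum_exp y
    have n0 : Summable fun k : ℕ => ‖x 0 ^ k / (k.factorial : ℝ)‖ := by
      refine (h0 |x 0|).summable.congr fun k => ?_
      rw [norm_div, norm_pow, Real.norm_natCast, Real.norm_eq_abs]
    have n1 : Summable fun b : Fin m → ℕ =>
        ‖∏ i, (x i.succ ^ b i / ((b i).factorial : ℝ))‖ := by
      refine (ih fun i => |x i.succ|).summable.congr fun b => ?_
      rw [norm_prod]
      refine prod_congr rfl fun i _ => ?_
      rw [norm_div, norm_pow, Real.norm_natCast, Real.norm_eq_abs]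
    have hs := HasSum.mul (h0 (x 0)) (ih fun i => x i.succ)
      (summable_mul_of_summable_norm (f := fun k : ℕ => x 0 ^ k / (k.factorial : ℝ))
        (g := fun b : Fin m → ℕ => ∏ i, (x i.succ ^ b i / ((b i).factorial : ℝ))) n0 n1)
    rw [← (Fin.consEquiv fun _ : Fin (m + 1) => ℕ).hasSum_iff, Fin.sum_univ_succ, Real.exp_add]
    refine (congrArg (fun f => HasSum f _) (funext fun p => ?_)).mp hs
    simp [Fin.prod_univ_succ, Fin.consEquiv, div_mul_div_comm]

theorem sum_sum_tridiagonal {m : ℕ} (A : Matrix (Fin (m + 1)) (Fin (m + 1)) ℝ)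
    (hA : IsTridiagonal A) (hsymm : A.IsSymm) (t : Fin (m + 1) → ℝ) :
    ∑ i, ∑ j, A i j * (t i * t j) =
      ∑ i, A i i * t i ^ 2 +
        2 * ∑ i : Fin m, A i.castSucc i.succ * (t i.castSucc * t i.succ) := by
  induction m with
  | zero => simp [pow_two]
  | succ m ih =>
    have ih' := ih (A.submatrix Fin.succ Fin.succ)
      (fun i j h => hA _ _ (by simpa using h)) (hsymm.submatrix _) (fun i => t i.succ)
    have h1 : ∑ j : Fin (m + 1), A 0 j.succ * (t 0 * t j.succ) = A 0 1 * (t 0 * t 1) := by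
      rw [Fin.sum_univ_succ, Finset.sum_eq_zero]
      · simp
      · intro j _
        rw [hA _ _ (Or.inl (by simp)), zero_mul]
    have h2 : ∑ j : Fin (m + 1), A j.succ 0 * (t j.succ * t 0) = A 0 1 * (t 0 * t 1) := by
      rw [← h1]
      exact Finset.sum_congr rfl fun j _ => by rw [hsymm.apply, mul_comm (t 0)]
    simp only [Matrix.submatrix_apply] at ih'
    rw [Fin.sum_univ_succ]
    simp only [Fin.sum_univ_succ (n := m + 1)] at h1 ⊢
    rw [h1, Finset.sum_add_distrib, h2, ih']
    rw [Fin.sum_univ_succ (n := m)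
      (f := fun i => A i.castSucc i.succ * (t i.castSucc * t i.succ))]
    simp only [Fin.castSucc_zero, Fin.succ_zero_eq_one, Fin.succ_castSucc]
    ring

/-- A path has no cycles, so signs can be propagated edge by edge without conflict: the new endpoint
copies or flips its neighbour's sign according to the sign of `β 0`. -/
theorem exists_signs {m : ℕ} (β : Fin m → ℝ) :
    ∃ d : Fin (m + 1) → ℝ, (∀ i, d i * d i = 1) ∧
      ∀ i : Fin m, d i.castSucc * d i.succ * β i = -|β i| := by
  induction m with
  | zero => exact ⟨1, by simp, fun i => i.elim0⟩
  | succ m ih =>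
    obtain ⟨d, hd, hβ⟩ := ih fun i => β i.succ
    rcases le_total 0 (β 0) with h | h
    · refine ⟨Fin.cons (-d 0) d, Fin.cases ?_ ?_, Fin.cases ?_ ?_⟩
      · simpa using hd 0
      · simpa using hd
      · simp [hd, abs_of_nonneg h]
      · simpa [← Fin.succ_castSucc] using hβ
    · refine ⟨Fin.cons (d 0) d, Fin.cases ?_ ?_, Fin.cases ?_ ?_⟩
      · simpa using hd 0
      · simpa using hd
      · simp [hd, abs_of_nonpos h]
      · simpa [← Fin.succ_castSucc] using hβ

theorem gram_apply {n : ℕ} (v : Fin n → EuclideanSpace ℝ (Fin n)) (i j : Fin n) :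
    ((generatorMatrix v).transpose * generatorMatrix v) i j = inner ℝ (v i) (v j) := by
  simp [Matrix.mul_apply, generatorMatrix, PiLp.inner_apply, mul_comm]

theorem exists_associatedMatrix_eq {m : ℕ} (v : Fin (m + 1) → EuclideanSpace ℝ (Fin (m + 1)))
    (hunit : ∀ i, ‖v i‖ = 1)
    (htri : IsTridiagonal ((generatorMatrix v).transpose * generatorMatrix v)) :
    ∃ d : Fin (m + 1) → ℝ, (∀ i, d i * d i = 1) ∧
      (∀ i : Fin m, d i.castSucc * d i.succ * beta v i = -|beta v i|) ∧
      associatedMatrix v = Matrix.diagonal d *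
        ((generatorMatrix v).transpose * generatorMatrix v) * Matrix.diagonal d := by
  obtain ⟨d, hd, hβ⟩ := exists_signs (beta v)
  refine ⟨d, hd, hβ, ?_⟩
  have hnext (i j : Fin (m + 1)) (hij : (i : ℕ) + 1 = j) :
      d i * inner ℝ (v i) (v j) * d j = -|inner ℝ (v i) (v j)| := by
    obtain ⟨k, rfl, rfl⟩ : ∃ k : Fin m, k.castSucc = i ∧ k.succ = j :=
      ⟨⟨i, by omega⟩, rfl, Fin.ext hij⟩
    rw [← beta.eq_1 v k, ← hβ k]
    ring
  ext i j
  rw [Matrix.mul_diagonal, Matrix.diagonal_mul, gram_apply, associatedMatrix, Matrix.of_apply]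
  split_ifs with h
  · subst h
    rw [real_inner_self_eq_norm_sq, hunit, mul_right_comm, hd]
    norm_num
  · have hne : (i : ℕ) ≠ j := fun e => h (Fin.ext e)
    by_cases h1 : (i : ℕ) + 1 = j
    · rw [hnext i j h1]
    by_cases h2 : (j : ℕ) + 1 = i
    · rw [real_inner_comm, ← hnext j i h2]
      ring
    · rw [← gram_apply, htri i j (by omega)]
      simp

theorem isUnit_det_generatorMatrix {n : ℕ} {v : Fin n → EuclideanSpace ℝ (Fin n)}
    (hv : LinearIndependent ℝ v) : IsUnit (generatorMatrix v).det := by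
  rw [← Matrix.isUnit_iff_isUnit_det, ← Matrix.linearIndependent_cols_iff_isUnit]
  exact hv.map' (WithLp.linearEquiv 2 ℝ (Fin n → ℝ)).toLinearMap (LinearEquiv.ker _)

theorem norm_sq_mulVec {n : ℕ} (W : Matrix (Fin n) (Fin n) ℝ) (t : Fin n → ℝ) :
    ‖WithLp.toLp 2 (W.mulVec t)‖ ^ 2 = ∑ i, ∑ j, (W.transpose * W) i j * (t i * t j) := by
  rw [EuclideanSpace.norm_sq_eq]
  simp only [Real.norm_eq_abs, sq_abs, Matrix.mulVec, dotProduct, Matrix.mul_apply,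
    Matrix.transpose_apply]
  simp_rw [sq, Finset.sum_mul_sum, Finset.sum_mul]
  rw [Finset.sum_comm]
  refine Finset.sum_congr rfl fun i _ => ?_
  rw [Finset.sum_comm]
  exact Finset.sum_congr rfl fun j _ => Finset.sum_congr rfl fun k _ => by ring

end SolidAngle

/-! ### Gaussian integrals over cones. -/

namespace SolidAngle

/-- Membership in a cone depends only on direction, so in polar coordinates the integrand splits
into an angular and a radial factor. -/
theorem setIntegral_fun_norm_of_isCone {E : Type*} [NormedAddCommGroup E] [NormedSpace ℝ E]
    [MeasurableSpace E] [BorelSpace E] [FiniteDimensional ℝ E] [Nontrivial E]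
    (μ : Measure E) [μ.IsAddHaarMeasure] {C : Set E} (hC : MeasurableSet C)
    (hsmul : ∀ r : ℝ, 0 < r → ∀ x, r • x ∈ C ↔ x ∈ C) (f : ℝ → ℝ) :
    ∫ x in C, f ‖x‖ ∂μ =
      μ.toSphere.real {x : Metric.sphere (0 : E) 1 | (x : E) ∈ C} *
        ∫ r : Set.Ioi (0 : ℝ), f r ∂.volumeIoiPow (Module.finrank ℝ E - 1) := by
  set S : Set (Metric.sphere (0 : E) 1) := {x | (x : E) ∈ C} with hSdef
  have hS : MeasurableSet S := measurable_subtype_coe hC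
  calc
    ∫ x in C, f ‖x‖ ∂μ = ∫ x, C.indicator 1 x * f ‖x‖ ∂μ := by
      rw [← integral_indicator hC]
      congr 1 with x
      by_cases hx : x ∈ C <;> simp [hx]
    _ = ∫ x : ({(0)}ᶜ : Set E), C.indicator 1 x.1 * f ‖x.1‖ ∂(μ.comap (↑)) := by
      rw [integral_subtype_comap (measurableSet_singleton _).compl
        fun x ↦ C.indicator 1 x * f ‖x‖, restrict_compl_singleton]
    _ = ∫ p, S.indicator 1 p.1 * f p.2 ∂μ.toSphere.prod (.volumeIoiPow (Module.finrank ℝ E - 1)) := by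
      rw [← μ.measurePreserving_homeomorphUnitSphereProd.integral_comp
        (Homeomorph.measurableEmbedding _)
        fun p : Metric.sphere (0 : E) 1 × Set.Ioi (0 : ℝ) => S.indicator 1 p.1 * f p.2]
      congr 1 with x
      have h0 : (0 : ℝ) < ‖x.1‖⁻¹ := inv_pos.2 (norm_pos_iff.2 x.2)
      have := hsmul _ h0 x.1
      by_cases hx : x.1 ∈ C <;> simp_all [Set.indicator]
    _ = _ := by
      rw [integral_prod_mul (S.indicator 1) fun r : Set.Ioi (0 : ℝ) => f r,
        integral_indicator_one hS]

/-- Comparison with the whole space cancels the radial integral, which is never evaluated. -/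
theorem setIntegral_exp_neg_norm_sq_of_isCone {m : ℕ}
    {C : Set (EuclideanSpace ℝ (Fin (m + 1)))} (hC : MeasurableSet C)
    (hsmul : ∀ r : ℝ, 0 < r → ∀ x, r • x ∈ C ↔ x ∈ C) :
    ∫ x in C, Real.exp (-‖x‖ ^ 2) = Real.pi ^ (((m + 1 : ℕ) : ℝ) / 2) * solidAngle C := by
  have h1 := setIntegral_fun_norm_of_isCone volume hC hsmul fun r => Real.exp (-r ^ 2)
  have h2 := setIntegral_fun_norm_of_isCone
    (volume : Measure (EuclideanSpace ℝ (Fin (m + 1)))) MeasurableSet.univ (by simp)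
    fun r => Real.exp (-r ^ 2)
  have h3 := GaussianFourier.integral_rexp_neg_mul_sq_norm
    (V := EuclideanSpace ℝ (Fin (m + 1))) one_pos
  simp only [finrank_euclideanSpace_fin, div_one, neg_mul, one_mul] at h3
  simp only [Measure.restrict_univ, Set.mem_univ, Set.ofPred_true] at h2
  have hpos : (0 : ℝ) < Real.pi ^ (((m + 1 : ℕ) : ℝ) / 2) := Real.rpow_pos_of_pos Real.pi_pos _
  rw [h3] at h2
  have hne := hpos.ne'
  rw [h2] at hne
  rw [h1, h2, solidAngle]
  have := left_ne_zero_of_mul hne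
  field_simp

theorem integral_Ici_pow_mul_exp_neg_sq (k : ℕ) :
    ∫ x in Set.Ici (0 : ℝ), x ^ k * Real.exp (-x ^ 2) =
      1 / 2 * Real.Gamma ((1 + (k : ℝ)) / 2) := by
  have h := integral_rpow_mul_exp_neg_rpow (p := 2) (q := k) two_pos
    (by linarith [k.cast_nonneg (α := ℝ)])
  rw [integral_Ici_eq_integral_Ioi, add_comm 1 (k : ℝ), ← h]
  simp [Real.rpow_natCast]

variable {n : ℕ}

/-- The closed nonnegative orthant. -/
def orthant (n : ℕ) : Set (Fin n → ℝ) := Set.univ.pi fun _ => Set.Ici 0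

theorem measurableSet_orthant : MeasurableSet (orthant n) :=
  MeasurableSet.univ_pi fun _ => measurableSet_Ici

theorem integrable_exp_neg_norm_mulVec_sq {W : Matrix (Fin n) (Fin n) ℝ} (hW : IsUnit W.det) :
    Integrable fun t : Fin n → ℝ => Real.exp (-‖WithLp.toLp 2 (W.mulVec t)‖ ^ 2) := by
  have h0 : Integrable fun x : EuclideanSpace ℝ (Fin n) => Real.exp (-‖x‖ ^ 2) := by
    -- A non-integrable function has integral `0` by convention, but the Gaussian integral is
    -- positive.
    by_contra h
    have h3 := GaussianFourier.integral_rexp_neg_mul_sq_norm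
      (V := EuclideanSpace ℝ (Fin n)) one_pos
    simp only [finrank_euclideanSpace_fin, div_one, neg_mul, one_mul] at h3
    rw [integral_undef h] at h3
    exact (Real.rpow_pos_of_pos Real.pi_pos _).ne h3
  have h1 := (PiLp.volume_preserving_toLp (Fin n)).integrable_comp_of_integrable h0
  have hinj : Function.Injective W.mulVec := Matrix.mulVec_injective_iff_isUnit.2
    ((Matrix.isUnit_iff_isUnit_det _).2 hW)
  have hsurj : Function.Surjective W.mulVec := Matrix.mulVec_surjective_iff_isUnit.2
    ((Matrix.isUnit_iff_isUnit_det _).2 hW)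
  have h2 := integrableOn_image_iff_integrableOn_abs_det_fderiv_smul volume MeasurableSet.univ
    (fun x _ => (LinearMap.toContinuousLinearMap W.toLin').hasFDerivAt.hasFDerivWithinAt (x := x))
    (Set.injOn_of_injective (f := LinearMap.toContinuousLinearMap W.toLin') hinj)
    fun y => Real.exp (-‖WithLp.toLp 2 y‖ ^ 2)
  have hdet : (LinearMap.toContinuousLinearMap W.toLin').det = W.det := by simp
  rw [Set.image_univ_of_surjective (f := LinearMap.toContinuousLinearMap W.toLin') hsurj,
    integrableOn_univ, integrableOn_univ, hdet] at h2
  exact (integrable_smul_iff (abs_ne_zero.2 hW.ne_zero) _).1 (h2.1 h1)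

theorem setIntegral_image_orthant {W : Matrix (Fin n) (Fin n) ℝ} (hW : IsUnit W.det) :
    ∫ x in WithLp.toLp 2 '' (W.mulVec '' orthant n), Real.exp (-‖x‖ ^ 2) =
      |W.det| * ∫ t in orthant n, Real.exp (-‖WithLp.toLp 2 (W.mulVec t)‖ ^ 2) := by
  have hinj : Function.Injective W.mulVec := Matrix.mulVec_injective_iff_isUnit.2
    ((Matrix.isUnit_iff_isUnit_det _).2 hW)
  have h2 := integral_image_eq_integral_abs_det_fderiv_smul volume (measurableSet_orthant (n := n))
    (fun x _ => (LinearMap.toContinuousLinearMap W.toLin').hasFDerivAt.hasFDerivWithinAt (x := x))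
    (Set.injOn_of_injective (f := LinearMap.toContinuousLinearMap W.toLin') hinj)
    fun y => Real.exp (-‖WithLp.toLp 2 y‖ ^ 2)
  have hdet : (LinearMap.toContinuousLinearMap W.toLin').det = W.det := by simp
  rw [hdet] at h2
  rw [← integral_const_mul]
  refine Eq.trans ?_ h2
  have hemb := (MeasurableEquiv.toLp 2 (Fin n → ℝ)).measurableEmbedding
  exact (PiLp.volume_preserving_toLp (Fin n)).setIntegral_image_emb hemb
    (fun x => Real.exp (-‖x‖ ^ 2)) _

theorem mem_cone_iff (v : Fin n → EuclideanSpace ℝ (Fin n)) (x : EuclideanSpace ℝ (Fin n)) :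
    x ∈ cone v ↔ ∃ t ∈ orthant n, WithLp.toLp 2 ((generatorMatrix v).mulVec t) = x := by
  have key (t : Fin n → ℝ) :
      WithLp.toLp 2 ((generatorMatrix v).mulVec t) = ∑ i, t i • v i := by
    ext r
    simp [Matrix.mulVec, dotProduct, generatorMatrix, mul_comm]
  rw [cone, PointedCone.hull, Submodule.mem_span_range_iff_exists_fun]
  constructor
  · rintro ⟨c, rfl⟩
    exact ⟨fun i => c i, fun i _ => (c i).2, key _⟩
  · rintro ⟨t, ht, rfl⟩
    exact ⟨fun i => ⟨t i, ht i trivial⟩, (key t).symm⟩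

theorem measurableSet_cone {v : Fin n → EuclideanSpace ℝ (Fin n)}
    (hv : IsUnit (generatorMatrix v).det) :
    MeasurableSet (cone v : Set (EuclideanSpace ℝ (Fin n))) := by
  -- Since `V` is invertible, the cone is the preimage of the orthant under the continuous map
  -- `V⁻¹`.
  have : (cone v : Set (EuclideanSpace ℝ (Fin n))) =
      (fun x => (generatorMatrix v)⁻¹.mulVec (WithLp.ofLp x)) ⁻¹' orthant n := by
    ext x
    rw [SetLike.mem_coe, mem_cone_iff, Set.mem_preimage]
    constructor
    · rintro ⟨t, ht, rfl⟩
      simpa [Matrix.mulVec_mulVec, Matrix.nonsing_inv_mul _ hv] using ht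
    · intro h
      exact ⟨_, h, by simp [Matrix.mulVec_mulVec, Matrix.mul_nonsing_inv _ hv]⟩
  rw [this]
  have hc : Continuous fun x : EuclideanSpace ℝ (Fin n) =>
      (generatorMatrix v)⁻¹.mulVec (WithLp.ofLp x) :=
    Continuous.matrix_mulVec continuous_const (PiLp.continuous_ofLp 2 _)
  exact hc.measurable measurableSet_orthant

theorem smul_mem_cone_iff (v : Fin n → EuclideanSpace ℝ (Fin n)) (r : ℝ) (hr : 0 < r)
    (x : EuclideanSpace ℝ (Fin n)) : r • x ∈ cone v ↔ x ∈ cone v := by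
  have key (r : ℝ) (hr : 0 ≤ r) (x : EuclideanSpace ℝ (Fin n)) (hx : x ∈ cone v) :
      r • x ∈ cone v := (cone v).smul_mem hr hx
  refine ⟨fun h => ?_, key r hr.le x⟩
  simpa [smul_smul, inv_mul_cancel₀ hr.ne'] using key r⁻¹ (inv_nonneg.2 hr.le) _ h

end SolidAngle

/-! ### Series expansion and termwise integration. -/

namespace SolidAngle

/-- The quadratic form with unit diagonal and off-diagonal entries `β i` at `(i, i + 1)`. -/
def chainForm {m : ℕ} (β : Fin m → ℝ) (t : Fin (m + 1) → ℝ) : ℝ :=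
  ∑ i, t i ^ 2 + 2 * ∑ i, β i * (t i.castSucc * t i.succ)

/-- The integrand obtained by expanding `exp (-chainForm β t)` in powers of `β`. -/
noncomputable def expansionTerm {m : ℕ} (β : Fin m → ℝ) (b : Fin m → ℕ) (t : Fin (m + 1) → ℝ) : ℝ :=
  (∏ i, ((-2 * (β i * (t i.castSucc * t i.succ))) ^ b i / ((b i).factorial : ℝ))) *
    Real.exp (-∑ i, t i ^ 2)

theorem hasSum_expansionTerm {m : ℕ} (β : Fin m → ℝ) (t : Fin (m + 1) → ℝ) :
    HasSum (fun b => expansionTerm β b t) (Real.exp (-chainForm β t)) := by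
  have h := (hasSum_prod_pow_div_factorial
    fun i => -2 * (β i * (t i.castSucc * t i.succ))).mul_right (Real.exp (-∑ i, t i ^ 2))
  rw [← Real.exp_add, ← Finset.mul_sum] at h
  rw [chainForm, neg_add, ← neg_mul, add_comm]
  exact h

/-- Each `tᵢ` occurs in the cross terms on both sides of it; `Fin.cons 0 b` and `Fin.snoc b 0`
supply the two exponents, with zeros at the ends. The variables then separate. -/
theorem expansionTerm_eq {m : ℕ} (β : Fin m → ℝ) (b : Fin m → ℕ) (t : Fin (m + 1) → ℝ) :
    expansionTerm β b t =
      ((-2 : ℝ) ^ (∑ i, b i) / (∏ i, ((b i).factorial : ℝ)) * ∏ i, β i ^ b i) *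
        ∏ i, t i ^ ((Fin.cons 0 b : Fin (m + 1) → ℕ) i + (Fin.snoc b 0 : Fin (m + 1) → ℕ) i) *
          Real.exp (-t i ^ 2) := by
  have h1 : ∏ i, t i ^ (Fin.cons 0 b : Fin (m + 1) → ℕ) i = ∏ i, t i.succ ^ b i := by
    simp [Fin.prod_univ_succ]
  have h2 : ∏ i, t i ^ (Fin.snoc b 0 : Fin (m + 1) → ℕ) i = ∏ i, t i.castSucc ^ b i := by
    simp [Fin.prod_univ_castSucc]
  simp only [expansionTerm, pow_add, Finset.prod_mul_distrib, h1, h2, mul_pow,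
    Finset.prod_div_distrib, ← Real.exp_sum, Finset.sum_neg_distrib, Finset.prod_pow_eq_pow_sum]
  ring

theorem setIntegral_expansionTerm {m : ℕ} (β : Fin m → ℝ) (b : Fin m → ℕ) :
    ∫ t in orthant (m + 1), expansionTerm β b t =
      (1 / 2) ^ (m + 1) * (seriesCoeff b * ∏ i, β i ^ b i) := by
  simp only [expansionTerm_eq]
  rw [integral_const_mul, orthant, volume_pi, Measure.restrict_pi_pi,
    integral_fintype_prod_eq_prod (fun i (x : ℝ) =>
      x ^ ((Fin.cons 0 b : Fin (m + 1) → ℕ) i + (Fin.snoc b 0 : Fin (m + 1) → ℕ) i) *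
        Real.exp (-x ^ 2))]
  simp only [integral_Ici_pow_mul_exp_neg_sq, Finset.prod_mul_distrib, Finset.prod_const,
    Finset.card_univ, Fintype.card_fin, seriesCoeff, Nat.cast_add, add_assoc]
  ring

theorem norm_expansionTerm {m : ℕ} (β : Fin m → ℝ) (b : Fin m → ℕ) {t : Fin (m + 1) → ℝ}
    (ht : t ∈ orthant (m + 1)) :
    ‖expansionTerm β b t‖ = expansionTerm (fun i => -|β i|) b t := by
  have h (i : Fin (m + 1)) : |t i| = t i := abs_of_nonneg (ht i trivial)
  simp [expansionTerm, norm_mul, norm_prod, norm_div, norm_pow, h]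

theorem hasSum_setIntegral_expansionTerm {m : ℕ} (β : Fin m → ℝ)
    (hint : IntegrableOn (fun t => Real.exp (-chainForm (fun i => -|β i|) t))
      (orthant (m + 1))) :
    HasSum (fun b : Fin m → ℕ => (1 / 2) ^ (m + 1) * (seriesCoeff b * ∏ i, β i ^ b i))
      (∫ t in orthant (m + 1), Real.exp (-chainForm β t)) := by
  simp only [← setIntegral_expansionTerm]
  refine hasSum_integral_of_dominated_convergence
    (fun b t => expansionTerm (fun i => -|β i|) b t) (fun b => ?_) (fun b => ?_)
    (.of_forall fun t => (hasSum_expansionTerm _ t).summable) ?_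
    (.of_forall fun t => hasSum_expansionTerm _ t)
  · refine Continuous.aestronglyMeasurable ?_
    unfold expansionTerm
    fun_prop
  · filter_upwards [ae_restrict_mem measurableSet_orthant] with t ht
    exact (norm_expansionTerm β b ht).le
  · simp only [(hasSum_expansionTerm _ _).tsum_eq]
    exact hint

/-- The sign of the coefficient is `(-1)^(∑ bᵢ)`, which the substitution `-|β|` cancels. -/
theorem abs_seriesCoeff_mul_prod {m : ℕ} (β : Fin m → ℝ) (b : Fin m → ℕ) :
    |seriesCoeff b * ∏ i, β i ^ b i| = seriesCoeff b * ∏ i, (-|β i|) ^ b i := by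
  have hΓ : 0 ≤ ∏ i : Fin (m + 1), Real.Gamma ((1 + ((Fin.cons 0 b : Fin (m + 1) → ℕ) i : ℝ) +
      ((Fin.snoc b 0 : Fin (m + 1) → ℕ) i : ℝ)) / 2) :=
    Finset.prod_nonneg fun i _ => (Real.Gamma_pos_of_pos (by positivity)).le
  have hsign (i : Fin m) : (-|β i|) ^ b i = (-1) ^ b i * |β i| ^ b i := by
    rw [← mul_pow, neg_one_mul]
  have h2 : (-2 : ℝ) ^ (∑ i, b i) = (-1) ^ (∑ i, b i) * 2 ^ (∑ i, b i) := by
    rw [← mul_pow]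
    norm_num
  have h1 : ((-1 : ℝ) ^ (∑ i, b i)) * (-1) ^ (∑ i, b i) = 1 := by
    rw [← mul_pow]
    norm_num
  simp only [hsign, Finset.prod_mul_distrib, Finset.prod_pow_eq_pow_sum, abs_mul, abs_div,
    seriesCoeff, abs_of_nonneg hΓ, Finset.abs_prod, abs_pow, abs_neg, Nat.abs_ofNat, Nat.abs_cast]
  rw [h2]
  linear_combination (-(2 ^ (∑ i, b i) / (∏ i, ((b i).factorial : ℝ)) *
    (∏ i : Fin (m + 1), Real.Gamma ((1 + ((Fin.cons 0 b : Fin (m + 1) → ℕ) i : ℝ) +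
      ((Fin.snoc b 0 : Fin (m + 1) → ℕ) i : ℝ)) / 2)) * ∏ i, |β i| ^ b i)) * h1

theorem norm_sq_mulVec_generatorMatrix {m : ℕ}
    {v : Fin (m + 1) → EuclideanSpace ℝ (Fin (m + 1))} (hunit : ∀ i, ‖v i‖ = 1)
    (htri : IsTridiagonal ((generatorMatrix v).transpose * generatorMatrix v))
    (t : Fin (m + 1) → ℝ) :
    ‖WithLp.toLp 2 ((generatorMatrix v).mulVec t)‖ ^ 2 = chainForm (beta v) t := by
  rw [norm_sq_mulVec, sum_sum_tridiagonal _ htri (Matrix.isSymm_transpose_mul_self _)]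
  simp [gram_apply, chainForm, beta, hunit]

end SolidAngle

open SolidAngle in
theorem theorem4p1 (m : ℕ) (v : Fin (m + 1) → EuclideanSpace ℝ (Fin (m + 1)))
    (hv : LinearIndependent ℝ v) (hunit : ∀ i, ‖v i‖ = 1)
    (htri : IsTridiagonal ((generatorMatrix v).transpose * generatorMatrix v)) :
    (∀ t : ℝ,
      Module.End.HasEigenvalue (Matrix.toLin' (associatedMatrix v)) t ↔
        Module.End.HasEigenvalue
          (Matrix.toLin' ((generatorMatrix v).transpose * generatorMatrix v)) t) ∧
    (associatedMatrix v).charpoly =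
      ((generatorMatrix v).transpose * generatorMatrix v).charpoly ∧
    (associatedMatrix v).PosDef ∧
    Summable (fun b : Fin m → ℕ => |seriesTerm v b|) ∧
    HasSum (fun b : Fin m → ℕ => seriesTerm v b)
      (solidAngle (cone v : Set (EuclideanSpace ℝ (Fin (m + 1))))) := by
  obtain ⟨d, hd, hdβ, hM⟩ := exists_associatedMatrix_eq v hunit htri
  have hV := isUnit_det_generatorMatrix hv
  have hDD : Matrix.diagonal d * Matrix.diagonal d = 1 := by
    rw [Matrix.diagonal_mul_diagonal, funext hd, Matrix.diagonal_one]
  have hDu : IsUnit (Matrix.diagonal d) := .of_mul_eq_one _ hDD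
  have hW : IsUnit (generatorMatrix v * Matrix.diagonal d).det := by
    rw [Matrix.det_mul]
    exact hV.mul ((Matrix.isUnit_iff_isUnit_det _).1 hDu)
  have hchar : (associatedMatrix v).charpoly =
      ((generatorMatrix v).transpose * generatorMatrix v).charpoly := by
    rw [hM, Matrix.charpoly_mul_comm, ← mul_assoc, hDD, one_mul]
  have hpos : (associatedMatrix v).PosDef := by
    -- `M = (V D)ᵀ 1 (V D)` with `V D` invertible.
    have h := (Matrix.IsUnit.posDef_star_left_conjugate_iff
      ((Matrix.isUnit_iff_isUnit_det _).2 hW)).2 (Matrix.PosDef.one (n := Fin (m + 1)) (R := ℝ))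
    have hstar : star (generatorMatrix v * Matrix.diagonal d) =
        Matrix.diagonal d * (generatorMatrix v).transpose := by
      rw [Matrix.star_eq_conjTranspose, Matrix.conjTranspose_mul, Matrix.diagonal_conjTranspose,
        Matrix.conjTranspose_eq_transpose_of_trivial, star_trivial]
    rw [hstar, mul_one] at h
    rw [hM, mul_assoc, mul_assoc, ← mul_assoc]
    exact h
  have hint : IntegrableOn (fun t => Real.exp (-chainForm (fun i => -|beta v i|) t))
      (orthant (m + 1)) := by
    refine Integrable.integrableOn ?_
    refine (integrable_exp_neg_norm_mulVec_sq hW).congr (.of_forall fun t => ?_)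
    have hform : chainForm (beta v) ((Matrix.diagonal d).mulVec t) =
        chainForm (fun i => -|beta v i|) t := by
      simp only [chainForm, Matrix.mulVec_diagonal, mul_pow, pow_two (d _), hd, one_mul, ← hdβ]
      congr 2
      exact Finset.sum_congr rfl fun i _ => by ring
    dsimp only
    rw [← Matrix.mulVec_mulVec, norm_sq_mulVec_generatorMatrix hunit htri, hform]
  have hsum := hasSum_setIntegral_expansionTerm (beta v) hint
  -- At `-|β|` the series is that of the absolute values, whence absolute convergence.
  have habs := hasSum_setIntegral_expansionTerm (fun i => -|beta v i|) (by simpa using hint)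
  -- The `4^(n/2) = 2^n` accounts for the factor `1/2` from each half-line integral.
  have hconst : (4 * Real.pi) ^ (((m + 1 : ℕ) : ℝ) / 2) =
      2 ^ (m + 1) * Real.pi ^ (((m + 1 : ℕ) : ℝ) / 2) := by
    rw [Real.mul_rpow (by norm_num) Real.pi_pos.le, show (4 : ℝ) = 2 ^ (2 : ℝ) by norm_num,
      ← Real.rpow_mul (by norm_num), mul_div_cancel₀ _ two_ne_zero, Real.rpow_natCast]
  have hπ : (0 : ℝ) < Real.pi ^ (((m + 1 : ℕ) : ℝ) / 2) := Real.rpow_pos_of_pos Real.pi_pos _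
  have hangle : |(generatorMatrix v).det| / Real.pi ^ (((m + 1 : ℕ) : ℝ) / 2) *
      ∫ t in orthant (m + 1), Real.exp (-chainForm (beta v) t) = solidAngle (cone v :
        Set (EuclideanSpace ℝ (Fin (m + 1)))) := by
    have h1 := setIntegral_exp_neg_norm_sq_of_isCone (measurableSet_cone hV)
      (fun r hr x => smul_mem_cone_iff v r hr x)
    have hC : (cone v : Set (EuclideanSpace ℝ (Fin (m + 1)))) =
        WithLp.toLp 2 '' ((generatorMatrix v).mulVec '' orthant (m + 1)) := by
      ext x
      simp [mem_cone_iff]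
    have h2 := setIntegral_image_orthant hV
    rw [← hC, h1] at h2
    simp only [norm_sq_mulVec_generatorMatrix hunit htri] at h2
    rw [div_mul_eq_mul_div, ← h2, mul_div_cancel_left₀ _ hπ.ne']
  refine ⟨fun t => ?_, hchar, hpos, ?_, ?_⟩
  · rw [Module.End.hasEigenvalue_iff_isRoot_charpoly, Module.End.hasEigenvalue_iff_isRoot_charpoly,
      Matrix.charpoly_toLin', Matrix.charpoly_toLin', hchar]
  · refine (habs.summable.mul_left
      (|(generatorMatrix v).det| / Real.pi ^ (((m + 1 : ℕ) : ℝ) / 2))).congr fun b => ?_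
    have hc : 0 ≤ |(generatorMatrix v).det| / (4 * Real.pi) ^ (((m + 1 : ℕ) : ℝ) / 2) := by
      positivity
    rw [seriesTerm, abs_mul, abs_seriesCoeff_mul_prod, abs_of_nonneg hc, hconst, one_div, inv_pow]
    field_simp
  · rw [← hangle]
    refine (congrArg (fun f => HasSum f _) (funext fun b => ?_)).mp (hsum.mul_left _)
    rw [seriesTerm, hconst, one_div, inv_pow]
    field_simp
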